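/- A paratopological group is a group with a Hausdorff topology for which the multiplication is jointly continuous; topological groups are Hausdorff as well, except that the group topologies in the definition of $\tau^\flat$ need not be. For a paratopological group $(G,\tau)$ let $\tau^\flat$ be the strongest group topology on $G$ that is weaker than $\tau$, and let $G^\flat=(G,\tau^\flat)$; a subset of $G$ is $\flat$-closed if it is closed in $\tau^\flat$. $G$ is totally bounded if for every neighborhood $U$ of the unit there is a finite set $F\subset G$ with $FU=UF=G$. The character $\chi(X)$ of a space $X$ is the smallest cardinal $\kappa$ such that each point of $X$ has a neighborhood base of size $\le\kappa$. A continuous map $h:X\to Y$ is regular if for each $x\in X$ and each neighborhood $U$ of $x$ there is a closed set $F\subset Y$ such that $h^{-1}(F)$ is a closed neighborhood of $x$ with $h^{-1}(F)\subset U$. A paratopological group $H$ is fcBohr regular if there is a regular continuous homomorphism from $H$ onto a first-countable totally bounded topological group. **Corollary.** A paratopological group $H$ is fcBohr regular if and only if $H$ is (topologically isomorphic to) a $\flat$-closed subgroup of a regular totally bounded paratopological group $G$ with $$\aleph_0=\chi(G^\flat)\le\chi(G)=\max\{\chi(H),\aleph_0\}\quad\text{and}\quad |G/H|\le\aleph_0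 .$$ (For nondiscrete $H$ one has $\chi(H)\ge\aleph_0$, so that $\chi(G)=\chi(H)$.) -/

import Mathlib

open Topology
open scoped Pointwise Cardinal

universe u

/-- The topology of the group reflexion of a (para)topological group `G`: the strongest group
topology on `G` that is weaker than the given topology. In Mathlib's order `t ≤ s` means that `t`
is stronger (finer) than `s`; see `isLeast_flatTopology`. Group topologies are not required to be
Hausdorff here. -/
@[reducible]
def flatTopology (G : Type u) [Group G] [τ : TopologicalSpace G] : TopologicalSpace G :=
  sInf {t : TopologicalSpace G | τ ≤ t ∧ @IsTopologicalGroup G t _}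

/-- `flatTopology G` is indeed the strongest among the group topologies weaker than the given
one. -/
theorem isLeast_flatTopology (G : Type u) [Group G] [τ : TopologicalSpace G] :
    IsLeast {t : TopologicalSpace G | τ ≤ t ∧ @IsTopologicalGroup G t _} (flatTopology G) :=
  ⟨⟨le_sInf fun _ ht => ht.1, topologicalGroup_sInf fun _ ht => ht.2⟩, fun _ ht => sInf_le ht⟩

/-- A subset of `G` is `♭`-closed if it is closed in the topology of the group reflexion. -/
def IsFlatClosed {G : Type u} [Group G] [TopologicalSpace G] (A : Set G) : Prop :=
  IsClosed[flatTopology G] A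

/-- `B` is a neighborhood base at `x`. -/
def IsNhdsBase {X : Type u} (t : TopologicalSpace X) (x : X) (B : Set (Set X)) : Prop :=
  (∀ V ∈ B, V ∈ @nhds X t x) ∧ ∀ U ∈ @nhds X t x, ∃ V ∈ B, V ⊆ U

/-- The character of a space: the smallest cardinal `κ` such that every point has a neighborhood
base of cardinality at most `κ`. -/
noncomputable def character {X : Type u} (t : TopologicalSpace X) : Cardinal.{u} :=
  sInf {κ : Cardinal.{u} | ∀ x : X, ∃ B : Set (Set X), IsNhdsBase t x B ∧ #B ≤ κ}

/-- A (para)topological group is totally bounded if for every neighborhood `U` of the unit there is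
a finite set `F` with `F U = U F = G`. -/
def IsTotallyBoundedGroup (G : Type u) [Group G] [TopologicalSpace G] : Prop :=
  ∀ U ∈ 𝓝 (1 : G), ∃ F : Set G, F.Finite ∧ F * U = Set.univ ∧ U * F = Set.univ

/-- A continuous map `h` is regular if for each point `x` and neighborhood `U` of `x` there is a
closed set `F` in the codomain such that `h ⁻¹' F` is a closed neighborhood of `x` inside `U`. -/
def IsRegularMap {X Y : Type u} [TopologicalSpace X] [TopologicalSpace Y] (h : X → Y) : Prop :=
  Continuous h ∧ ∀ x : X, ∀ U ∈ 𝓝 x, ∃ F : Set Y,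
    IsClosed F ∧ IsClosed (h ⁻¹' F) ∧ h ⁻¹' F ∈ 𝓝 x ∧ h ⁻¹' F ⊆ U

/-- `H` is fcBohr regular if it admits a regular continuous homomorphism onto a (Hausdorff)
first-countable totally bounded topological group. -/
def IsFcBohrRegular (H : Type u) [Group H] [TopologicalSpace H] : Prop :=
  ∃ (K : Type u) (_ : Group K) (_ : TopologicalSpace K) (_ : IsTopologicalGroup K) (_ : T2Space K)
    (_ : FirstCountableTopology K) (h : H →* K),
    IsTotallyBoundedGroup K ∧ Function.Surjective h ∧ IsRegularMap h

/-! If `G` is regular and totally bounded, then `U⁻¹` has nonempty interior for every neighborhood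
`U` of the unit. Hence the sets `U * U⁻¹` form a base at the unit of a group topology weaker than
that of `G`, and they are ♭-neighborhoods. It follows that the ♭-closure of `A` lies in the closure
of `A * A` for small `A`, so `G` has a base of ♭-closed neighborhoods. Thus `G♭` is Hausdorff, the
identity `G → G♭` is regular, and its restriction to `H` witnesses fcBohr regularity.

Conversely, let `h : H → K` be a regular homomorphism as in the definition, let `ρ` be a
conjugation-invariant seminorm defining the topology of `K`, and let `M` be the group of rational
points of the circle with arc length `s` in `[0, 1)`. On `K × M` take as neighborhoods of the unit
the one-sided cones `s t < ε`, `dist(x, h(F)) ≤ s t`. Over `t = 1` a cone is the closure of `h(F)`,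
which by regularity of `h` recovers the topology of `H`. Over `t ≠ 1` it contains a ball of radius
`s t`, so each cone contains a nonempty open set of the product. Therefore the group reflexion is
the product topology, and total boundedness is inherited from it. The image of `H` is `K × {1}`,
with quotient of size at most that of the countable group `M`. -/

open Filter Set

/-! ### Character and neighborhood bases -/

section Character

theorem exists_isNhdsBase_mk_le_character {X : Type u} (t : TopologicalSpace X) (x : X) :
    ∃ B : Set (Set X), IsNhdsBase t x B ∧ #B ≤ character t := by
  have : character t ∈ {κ : Cardinal.{u} | ∀ x : X, ∃ B, IsNhdsBase t x B ∧ #B ≤ κ} :=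
    csInf_mem ⟨#(Set X), fun x => ⟨{V | V ∈ @nhds X t x},
      ⟨fun _ h => h, fun U hU => ⟨U, hU, subset_rfl⟩⟩, Cardinal.mk_set_le _⟩⟩
  exact this x

theorem character_le {X : Type u} {t : TopologicalSpace X} {κ : Cardinal.{u}}
    (h : ∀ x : X, ∃ B, IsNhdsBase t x B ∧ #B ≤ κ) : character t ≤ κ :=
  csInf_le' h

theorem IsNhdsBase.hasBasis {X : Type u} {t : TopologicalSpace X} {x : X} {B : Set (Set X)}
    (h : IsNhdsBase t x B) : (𝓝 x).HasBasis (fun V => V ∈ B) id :=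
  ⟨fun U => ⟨fun hU => h.2 U hU, fun ⟨V, hV, hVU⟩ => mem_of_superset (h.1 V hV) hVU⟩⟩

theorem firstCountableTopology_of_character_le {X : Type u} [t : TopologicalSpace X]
    (h : character t ≤ ℵ₀) : FirstCountableTopology X := by
  refine ⟨fun x => ?_⟩
  obtain ⟨B, hB, hcard⟩ := exists_isNhdsBase_mk_le_character t x
  exact HasCountableBasis.isCountablyGenerated
    ⟨hB.hasBasis, Cardinal.le_aleph0_iff_set_countable.1 (hcard.trans h)⟩

theorem character_le_aleph0 {X : Type u} [t : TopologicalSpace X] [FirstCountableTopology X] :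
    character t ≤ ℵ₀ := by
  refine character_le fun x => ?_
  obtain ⟨V, hV⟩ := (𝓝 x).exists_antitone_basis
  refine ⟨range V, ⟨?_, fun U hU => ?_⟩, ?_⟩
  · rintro _ ⟨n, rfl⟩
    exact hV.mem n
  · obtain ⟨n, hn⟩ := hV.mem_iff.1 hU
    exact ⟨V n, ⟨n, rfl⟩, hn⟩
  · exact Cardinal.le_aleph0_iff_set_countable.2 (countable_range V)

theorem aleph0_le_character {X : Type u} [t : TopologicalSpace X] [T1Space X] (x : X)
    [(𝓝[≠] x).NeBot] : ℵ₀ ≤ character t := by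
  by_contra! hlt
  obtain ⟨B, hB, hcard⟩ := exists_isNhdsBase_mk_le_character t x
  have hfin : B.Finite := Cardinal.lt_aleph0_iff_set_finite.1 (hcard.trans_lt hlt)
  have hmem : ⋂₀ B ∈ 𝓝 x := (sInter_mem hfin).2 hB.1
  have hsub : ⋂₀ B ⊆ {x} := by
    intro y hy
    by_contra hne
    obtain ⟨V, hV, hVy⟩ := hB.2 _ (isOpen_compl_singleton.mem_nhds (Ne.symm hne : x ≠ y))
    exact hVy (hy V hV) rfl
  have : 𝓝[≠] x = ⊥ :=
    mem_iff_inf_principal_compl.1 (mem_of_superset hmem hsub)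
  exact NeBot.ne inferInstance this

theorem Topology.IsInducing.character_le {X Y : Type u} [tX : TopologicalSpace X]
    [tY : TopologicalSpace Y] {f : X → Y} (hf : IsInducing f) : character tX ≤ character tY := by
  refine _root_.character_le fun x => ?_
  obtain ⟨B, hB, hcard⟩ := exists_isNhdsBase_mk_le_character tY (f x)
  refine ⟨(f ⁻¹' ·) '' B, ⟨?_, fun U hU => ?_⟩, Cardinal.mk_image_le.trans hcard⟩
  · rintro _ ⟨V, hV, rfl⟩
    rw [hf.nhds_eq_comap]
    exact preimage_mem_comap (hB.1 V hV)
  · rw [hf.nhds_eq_comap] at hU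
    obtain ⟨W, hW, hWU⟩ := hU
    obtain ⟨V, hV, hVW⟩ := hB.2 W hW
    exact ⟨_, ⟨V, hV, rfl⟩, (preimage_mono hVW).trans hWU⟩

end Character

/-! ### Permanence properties of total boundedness -/

section TotallyBounded

theorem IsTotallyBoundedGroup.mono {G : Type*} [Group G] {t s : TopologicalSpace G} (hts : t ≤ s)
    (h : @IsTotallyBoundedGroup G _ t) : @IsTotallyBoundedGroup G _ s :=
  fun U hU => h U (nhds_mono hts hU)

/-- The centers of the covering translates may lie outside the image of `f`. Replacing each by a
point of the image in the same translate costs the passage from `V` to `V⁻¹ * V`. -/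
theorem exists_finite_subset_mul_of_mul_eq_univ {H G : Type*} [Group H] [Group G] (f : H →* G)
    {V : Set G} {F : Set G} (hF : F.Finite) (hFV : F * V = univ) :
    ∃ E : Set H, E.Finite ∧ E * f ⁻¹' (V⁻¹ * V) = univ := by
  classical
  choose! g hg using fun (a : G) (h : ∃ x : H, f x ∈ a • V) => h
  refine ⟨g '' F, hF.image g, eq_univ_of_forall fun x => ?_⟩
  obtain ⟨a, ha, v, hv, hav⟩ := mem_mul.1 (hFV.symm ▸ mem_univ (f x) : f x ∈ F * V)
  obtain ⟨w, hw, hwa⟩ := hg a ⟨x, v, hv, hav⟩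
  refine mem_mul.2 ⟨g a, mem_image_of_mem g ha, (g a)⁻¹ * x, ?_, by group⟩
  refine mem_mul.2 ⟨w⁻¹, inv_mem_inv.2 hw, v, hv, ?_⟩
  simp only [smul_eq_mul] at hwa
  rw [map_mul, map_inv, ← hwa, ← hav]
  group

theorem IsTotallyBoundedGroup.induced {H G : Type*} [Group H] [Group G] [TopologicalSpace G]
    [IsTopologicalGroup G] (hG : IsTotallyBoundedGroup G) (f : H →* G) :
    @IsTotallyBoundedGroup H _ (TopologicalSpace.induced f inferInstance) := by
  intro U hU
  rw [nhds_induced, map_one] at hU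
  obtain ⟨O, hO, hOU⟩ := hU
  obtain ⟨V, hV, -, hVinv, hVO⟩ := exists_closed_nhds_one_inv_eq_mul_subset hO
  obtain ⟨F, hF, hFV, -⟩ := hG V hV
  obtain ⟨E, hE, hEV⟩ := exists_finite_subset_mul_of_mul_eq_univ f hF hFV
  rw [hVinv] at hEV
  refine ⟨E ∪ E⁻¹, hE.union hE.inv, ?_, ?_⟩
  · refine eq_univ_of_univ_subset (hEV ▸ mul_subset_mul subset_union_left ?_)
    exact (preimage_mono hVO).trans hOU
  · have hsymm : (f ⁻¹' (V * V))⁻¹ = f ⁻¹' (V * V) := by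
      ext x
      rw [Set.mem_inv, mem_preimage, mem_preimage, map_inv, ← Set.mem_inv, mul_inv_rev, hVinv]
    have := congrArg (·⁻¹) hEV
    simp only [mul_inv_rev, inv_univ, hsymm] at this
    refine eq_univ_of_univ_subset (this ▸ mul_subset_mul ?_ subset_union_right)
    exact (preimage_mono hVO).trans hOU

theorem isTotallyBoundedGroup_of_compactSpace {G : Type*} [Group G] [TopologicalSpace G]
    [IsTopologicalGroup G] [CompactSpace G] : IsTotallyBoundedGroup G := by
  have key : ∀ U ∈ 𝓝 (1 : G), ∃ F : Set G, F.Finite ∧ F * U = univ := by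
    intro U hU
    obtain ⟨t, ht⟩ := compact_covered_by_mul_left_translates isCompact_univ
      ⟨1, mem_interior_iff_mem_nhds.2 hU⟩
    refine ⟨((t : Set G))⁻¹, t.finite_toSet.inv, eq_univ_of_forall fun x => ?_⟩
    obtain ⟨g, hg, hgx⟩ := mem_iUnion₂.1 (ht (mem_univ x))
    exact mem_mul.2 ⟨g⁻¹, inv_mem_inv.2 hg, g * x, hgx, by group⟩
  intro U hU
  obtain ⟨F, hF, hFU⟩ := key U hU
  obtain ⟨E, hE, hEU⟩ := key U⁻¹ (inv_mem_nhds_one G hU)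
  refine ⟨F ∪ E⁻¹, hF.union hE.inv, ?_, ?_⟩
  · exact eq_univ_of_univ_subset (hFU ▸ mul_subset_mul_right subset_union_left)
  · have := congrArg (·⁻¹) hEU
    simp only [mul_inv_rev, inv_univ, inv_inv] at this
    exact eq_univ_of_univ_subset (this ▸ mul_subset_mul_left subset_union_right)

theorem IsTotallyBoundedGroup.prod {G H : Type*} [Group G] [Group H] [TopologicalSpace G]
    [TopologicalSpace H] (hG : IsTotallyBoundedGroup G) (hH : IsTotallyBoundedGroup H) :
    IsTotallyBoundedGroup (G × H) := by
  intro U hU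
  obtain ⟨V, hV, W, hW, hVW⟩ := mem_nhds_prod_iff.1 hU
  obtain ⟨A, hA, hAV, hVA⟩ := hG V hV
  obtain ⟨C, hC, hCW, hWC⟩ := hH W hW
  refine ⟨A ×ˢ C, hA.prod hC, ?_, ?_⟩
  · refine eq_univ_of_univ_subset (Subset.trans ?_ (mul_subset_mul_left hVW))
    rw [prod_mul_prod_comm, hAV, hCW, univ_prod_univ]
  · refine eq_univ_of_univ_subset (Subset.trans ?_ (mul_subset_mul_right hVW))
    rw [prod_mul_prod_comm, hVA, hWC, univ_prod_univ]

/-- In a totally bounded group, every set with nonempty interior has finitely many translates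
covering the group. -/
theorem IsTotallyBoundedGroup.exists_finite_of_isOpen {G : Type*} [Group G] [TopologicalSpace G]
    [ContinuousMul G] (hG : IsTotallyBoundedGroup G) {P : Set G} (hP : IsOpen P)
    (hne : P.Nonempty) : ∃ F : Set G, F.Finite ∧ F * P = univ ∧ P * F = univ := by
  obtain ⟨x, hx⟩ := hne
  have h₁ : (x * ·) ⁻¹' P ∈ 𝓝 (1 : G) :=
    (hP.preimage (continuous_const_mul x)).mem_nhds (by simpa using hx)
  have h₂ : (· * x) ⁻¹' P ∈ 𝓝 (1 : G) :=
    (hP.preimage (continuous_mul_const x)).mem_nhds (by simpa using hx)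
  obtain ⟨F, hF, hF₁, -⟩ := hG _ h₁
  obtain ⟨E, hE, -, hE₁⟩ := hG _ h₂
  refine ⟨F * {x⁻¹} ∪ {x⁻¹} * E, (hF.mul (finite_singleton _)).union
    ((finite_singleton _).mul hE), ?_, ?_⟩
  · refine eq_univ_of_univ_subset (hF₁ ▸ ?_)
    rintro _ ⟨a, ha, v, hv, rfl⟩
    exact mem_mul.2 ⟨a * x⁻¹, Or.inl (mul_mem_mul ha rfl), x * v, hv, by group⟩
  · refine eq_univ_of_univ_subset (hE₁ ▸ ?_)
    rintro _ ⟨v, hv, a, ha, rfl⟩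
    exact mem_mul.2 ⟨v * x, hv, x⁻¹ * a, Or.inr (mul_mem_mul rfl ha), by group⟩

end TotallyBounded

/-! ### The group reflexion of a totally bounded paratopological group -/

section Reflexion

theorem mem_closure_iff_forall_mem_nhds_one {G : Type*} [Group G] [TopologicalSpace G]
    [SeparatelyContinuousMul G] {A : Set G} {x : G} :
    x ∈ closure A ↔ ∀ O ∈ 𝓝 (1 : G), ∃ a ∈ A, x⁻¹ * a ∈ O := by
  rw [mem_closure_iff_nhds]
  refine ⟨fun h O hO => ?_, fun h O hO => ?_⟩
  · have : (x⁻¹ * ·) ⁻¹' O ∈ 𝓝 x :=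
      (continuous_const_mul x⁻¹).continuousAt.preimage_mem_nhds (by simpa using hO)
    obtain ⟨a, haO, ha⟩ := h _ this
    exact ⟨a, ha, haO⟩
  · have : (x * ·) ⁻¹' O ∈ 𝓝 (1 : G) :=
      (continuous_const_mul x).continuousAt.preimage_mem_nhds (by simpa using hO)
    obtain ⟨a, ha, haO⟩ := h _ this
    exact ⟨a, by simpa using haO, ha⟩

variable {G : Type u} [Group G] [τ : TopologicalSpace G]

theorem isTopologicalGroup_flatTopology : @IsTopologicalGroup G (flatTopology G) _ :=
  (isLeast_flatTopology G).1.2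

theorem le_flatTopology : τ ≤ flatTopology G :=
  (isLeast_flatTopology G).1.1

variable [ContinuousMul G]

/-- Totally bounded paratopological groups are saturated. -/
theorem IsTotallyBoundedGroup.nonempty_interior_inv (hG : IsTotallyBoundedGroup G) {U : Set G}
    (hU : U ∈ 𝓝 (1 : G)) : (interior U⁻¹).Nonempty := by
  obtain ⟨V, hV, hV1, hVU⟩ := exists_open_nhds_one_mul_subset hU
  obtain ⟨F, hF, hFV, -⟩ := hG V (hV.mem_nhds hV1)
  -- If `U⁻¹` had empty interior, `V⁻¹` would be nowhere dense, yet finitely many of its right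
  -- translates cover `G`.
  have hcl : closure V⁻¹ ⊆ U⁻¹ := by
    intro g hg
    obtain ⟨a, ha, hga⟩ := mem_closure_iff_forall_mem_nhds_one.1 hg V (hV.mem_nhds hV1)
    rw [Set.mem_inv, show g⁻¹ = g⁻¹ * a * a⁻¹ by group]
    exact hVU (mul_mem_mul hga ha)
  by_contra hempty
  have hint : interior (closure V⁻¹) = ∅ :=
    subset_empty_iff.1 ((interior_mono hcl).trans (not_nonempty_iff_eq_empty.1 hempty).subset)
  have key : ∀ E : Set G, E.Finite → IsClosed (⋃ f ∈ E, (· * f) ⁻¹' closure V⁻¹) ∧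
      interior (⋃ f ∈ E, (· * f) ⁻¹' closure V⁻¹) = ∅ := by
    intro E hE
    induction E, hE using Set.Finite.induction_on with
    | empty => simp
    | @insert f E _ _ ih =>
      have hf : IsClosed ((· * f) ⁻¹' closure V⁻¹) :=
        isClosed_closure.preimage (continuous_mul_const f)
      rw [biUnion_insert]
      refine ⟨hf.union ih.1, ?_⟩
      rw [interior_union_isClosed_of_interior_empty hf ih.2]
      exact ((Homeomorph.mulRight f).preimage_interior _).symm.trans (by rw [hint, preimage_empty])
  have huniv : ⋃ f ∈ F, (· * f) ⁻¹' closure V⁻¹ = univ := by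
    refine eq_univ_of_forall fun x => ?_
    obtain ⟨f, hf, v, hv, hfv⟩ := mem_mul.1 (hFV.symm ▸ mem_univ x⁻¹ : x⁻¹ ∈ F * V)
    refine mem_iUnion₂.2 ⟨f, hf, subset_closure ?_⟩
    have : (x * f)⁻¹ = v := by rw [mul_inv_rev, ← hfv, inv_mul_cancel_left]
    rw [Set.mem_inv, this]
    exact hv
  have := (key F hF).2
  rw [huniv, interior_univ] at this
  exact (univ_nonempty (α := G)).ne_empty this

/-- Take `O = x⁻¹ * V⁻¹` with `x` interior to `V⁻¹`; in `O⁻¹ * O` the factors `x` cancel. -/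
theorem IsTotallyBoundedGroup.exists_inv_mul_subset (hG : IsTotallyBoundedGroup G) {V : Set G}
    (hV : V ∈ 𝓝 (1 : G)) : ∃ O ∈ 𝓝 (1 : G), O⁻¹ * O ⊆ V * V⁻¹ := by
  obtain ⟨x, hx⟩ := hG.nonempty_interior_inv hV
  refine ⟨(x * ·) ⁻¹' V⁻¹, (continuous_const_mul x).continuousAt.preimage_mem_nhds
    (by simpa using mem_interior_iff_mem_nhds.1 hx), ?_⟩
  rintro _ ⟨a, ha, b, hb, rfl⟩
  refine mem_mul.2 ⟨a * x⁻¹, ?_, x * b, hb, by group⟩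
  have : (x * a⁻¹)⁻¹ ∈ V := ha
  rwa [mul_inv_rev, inv_inv] at this

/-- In a totally bounded paratopological group, the sets `U * U⁻¹` with `U` a neighborhood of the
unit form a basis of a group topology. -/
@[reducible]
def IsTotallyBoundedGroup.groupFilterBasis (hG : IsTotallyBoundedGroup G) :
    GroupFilterBasis G where
  sets := {W | ∃ U ∈ 𝓝 (1 : G), W = U * U⁻¹}
  nonempty := ⟨_, univ, univ_mem, rfl⟩
  inter_sets := by
    rintro _ _ ⟨U, hU, rfl⟩ ⟨V, hV, rfl⟩
    exact ⟨_, ⟨U ∩ V, inter_mem hU hV, rfl⟩, subset_inter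
      (mul_subset_mul inter_subset_left (inv_subset_inv.2 inter_subset_left))
      (mul_subset_mul inter_subset_right (inv_subset_inv.2 inter_subset_right))⟩
  one' := by
    rintro _ ⟨U, hU, rfl⟩
    exact mem_mul.2 ⟨1, mem_of_mem_nhds hU, 1, by simpa using mem_of_mem_nhds hU, mul_one 1⟩
  mul' := by
    rintro _ ⟨U, hU, rfl⟩
    obtain ⟨V, hVo, hV1, hVU⟩ := exists_open_nhds_one_mul_subset hU
    have hV := hVo.mem_nhds hV1
    obtain ⟨O, hO, hOV⟩ := hG.exists_inv_mul_subset hV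
    refine ⟨_, ⟨V ∩ O, inter_mem hV hO, rfl⟩, ?_⟩
    -- Total boundedness enters here: it lets the inner `O⁻¹ * O` be exchanged for `V * V⁻¹`.
    calc (V ∩ O) * (V ∩ O)⁻¹ * ((V ∩ O) * (V ∩ O)⁻¹)
        = (V ∩ O) * ((V ∩ O)⁻¹ * (V ∩ O)) * (V ∩ O)⁻¹ := by simp only [mul_assoc]
      _ ⊆ V * (O⁻¹ * O) * V⁻¹ := by gcongr <;> simp
      _ ⊆ V * (V * V⁻¹) * V⁻¹ := by gcongr
      _ = V * V * (V * V)⁻¹ := by simp only [mul_assoc, mul_inv_rev]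
      _ ⊆ U * U⁻¹ := mul_subset_mul hVU (inv_subset_inv.2 hVU)
  inv' := by
    rintro _ ⟨U, hU, rfl⟩
    refine ⟨_, ⟨U, hU, rfl⟩, fun x hx => ?_⟩
    rw [mem_preimage, ← Set.mem_inv, mul_inv_rev, inv_inv]
    exact hx
  conj' := by
    rintro x _ ⟨U, hU, rfl⟩
    refine ⟨_, ⟨(fun y => x * y * x⁻¹) ⁻¹' U,
      (by fun_prop : Continuous fun y => x * y * x⁻¹).continuousAt.preimage_mem_nhds
        (by simpa using hU), rfl⟩, ?_⟩
    rintro _ ⟨a, ha, b, hb, rfl⟩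
    refine mem_mul.2 ⟨_, ha, x * b * x⁻¹, ?_, by group⟩
    have : x * b⁻¹ * x⁻¹ ∈ U := hb
    rw [Set.mem_inv]
    convert this using 1
    group

theorem IsTotallyBoundedGroup.mul_inv_mem_nhds_flatTopology (hG : IsTotallyBoundedGroup G)
    {U : Set G} (hU : U ∈ 𝓝 (1 : G)) : U * U⁻¹ ∈ @nhds G (flatTopology G) 1 := by
  have hle : flatTopology G ≤ hG.groupFilterBasis.topology := by
    refine (isLeast_flatTopology G).2 ⟨?_, hG.groupFilterBasis.isTopologicalGroup⟩
    refine le_of_nhds_le_nhds fun x => ?_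
    rw [(hG.groupFilterBasis.nhds_hasBasis x).ge_iff]
    rintro _ ⟨V, hV, rfl⟩
    have : (x⁻¹ * ·) ⁻¹' V ∈ 𝓝 x :=
      (continuous_const_mul x⁻¹).continuousAt.preimage_mem_nhds (by simpa using hV)
    filter_upwards [this] with y hy
    refine ⟨x⁻¹ * y, mem_mul.2 ⟨_, hy, 1, by simpa using mem_of_mem_nhds hV, mul_one _⟩, ?_⟩
    simp
  exact nhds_mono hle (hG.groupFilterBasis.mem_nhds_one ⟨U, hU, rfl⟩)

theorem IsTotallyBoundedGroup.exists_isFlatClosed_subset [T3Space G]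
    (hG : IsTotallyBoundedGroup G) {U : Set G} (hU : U ∈ 𝓝 (1 : G)) :
    ∃ C ∈ 𝓝 (1 : G), IsFlatClosed C ∧ C ⊆ U := by
  obtain ⟨D, hD, hDc, hDU⟩ := exists_mem_nhds_isClosed_subset hU
  obtain ⟨A, hAo, hA1, hAD⟩ := exists_open_nhds_one_mul_subset hD
  have hA := hAo.mem_nhds hA1
  have hgrp := isTopologicalGroup_flatTopology (G := G)
  refine ⟨@closure G (flatTopology G) A, mem_of_superset hA (@subset_closure G (flatTopology G) A),
    @isClosed_closure G (flatTopology G) A, Subset.trans (fun g hg => ?_) hDU⟩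
  rw [← hDc.closure_eq, mem_closure_iff_forall_mem_nhds_one]
  intro O hO
  have hclosure := (let := flatTopology G; mem_closure_iff_forall_mem_nhds_one (A := A) (x := g)).1
    hg
  -- From `g⁻¹ * a = u * v` one gets `g * u = a * v⁻¹`, a point of `A * A` in the translate `g * O`;
  -- so `g` is in the closure of `D`.
  obtain ⟨a, ha, u, hu, v, hv, huv⟩ :=
    hclosure _ (hG.mul_inv_mem_nhds_flatTopology (inter_mem hO hA))
  refine ⟨g * u, hAD (mem_mul.2 ⟨a, ha, v⁻¹, hv.2, ?_⟩), by simpa using hu.1⟩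
  simp only at huv
  rw [← mul_inv_cancel_left g a, ← huv]
  group

theorem IsTotallyBoundedGroup.t2Space_flatTopology [T3Space G] (hG : IsTotallyBoundedGroup G) :
    @T2Space G (flatTopology G) := by
  have hgrp := isTopologicalGroup_flatTopology (G := G)
  have hone : IsClosed[flatTopology G] ({1} : Set G) := by
    have : ({1} : Set G) = ⋂₀ {C | C ∈ 𝓝 (1 : G) ∧ IsFlatClosed C} := by
      refine Subset.antisymm ?_ fun x hx => ?_
      · rintro _ rfl C hC
        exact mem_of_mem_nhds hC.1
      · by_contra hne
        obtain ⟨C, hC, hCc, hCU⟩ := hG.exists_isFlatClosed_subset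
          (isOpen_compl_singleton.mem_nhds (Ne.symm hne : (1 : G) ≠ x))
        exact hCU (hx C ⟨hC, hCc⟩) rfl
    rw [this]
    exact @isClosed_sInter G (flatTopology G) _ fun C hC => hC.2
  let := flatTopology G
  have := IsTopologicalGroup.t1Space G hone
  infer_instance

/-- The target group is `H` itself with the topology induced from `G♭`, and the homomorphism is the
identity. -/
theorem IsTotallyBoundedGroup.isFcBohrRegular [T3Space G] (hG : IsTotallyBoundedGroup G)
    (hchar : character (flatTopology G) ≤ ℵ₀) {H : Type u} [Group H] [TopologicalSpace H]
    [ContinuousMul H] {f : H →* G} (hf : IsEmbedding f) : IsFcBohrRegular H := by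
  have hgrp := isTopologicalGroup_flatTopology (G := G)
  have hT2 := hG.t2Space_flatTopology
  have hfc := @firstCountableTopology_of_character_le G (flatTopology G) hchar
  have hle : (inferInstance : TopologicalSpace H) ≤ TopologicalSpace.induced f (flatTopology G) :=
    hf.eq_induced.le.trans (induced_mono le_flatTopology)
  refine ⟨H, inferInstance, TopologicalSpace.induced f (flatTopology G),
    (let := flatTopology G; topologicalGroup_induced f),
    @T2Space.of_injective_continuous H G (TopologicalSpace.induced f (flatTopology G))
      (flatTopology G) hT2 f hf.injective continuous_induced_dom,
    @TopologicalSpace.firstCountableTopology_induced H G (flatTopology G) hfc f, MonoidHom.id H,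
    @IsTotallyBoundedGroup.induced H G _ _ (flatTopology G) hgrp (hG.mono le_flatTopology) f,
    fun x => ⟨x, rfl⟩, continuous_id_iff_le.2 hle, fun x U hU => ?_⟩
  rw [hf.nhds_eq_comap] at hU
  obtain ⟨W, hW, hWU⟩ := hU
  obtain ⟨C, hC, hCc, hCW⟩ := hG.exists_isFlatClosed_subset (U := (f x * ·) ⁻¹' W)
    ((continuous_const_mul (f x)).continuousAt.preimage_mem_nhds (by simpa using hW))
  have hclosed : IsClosed[TopologicalSpace.induced f (flatTopology G)]
      (f ⁻¹' ((f x)⁻¹ * ·) ⁻¹' C) := by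
    let := flatTopology G
    exact isClosed_induced_iff.2
      ⟨((f x)⁻¹ * ·) ⁻¹' C, IsClosed.preimage (continuous_const_mul (f x)⁻¹) hCc, rfl⟩
  refine ⟨_, hclosed, hclosed.mono hle, ?_, fun y hy => hWU ?_⟩
  · refine (hf.continuous.const_mul (f x)⁻¹).continuousAt.preimage_mem_nhds ?_
    simpa using hC
  · simpa using hCW hy

end Reflexion

/-! ### Invariant seminorms on totally bounded groups -/

section InvariantSeminorm

variable {K : Type*} [Group K] [TopologicalSpace K] [IsTopologicalGroup K]

/-- A totally bounded topological group is balanced. -/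
theorem IsTotallyBoundedGroup.exists_forall_conj_mem (hK : IsTotallyBoundedGroup K) {U : Set K}
    (hU : U ∈ 𝓝 (1 : K)) : ∃ W ∈ 𝓝 (1 : K), ∀ x ∈ W, ∀ g : K, g * x * g⁻¹ ∈ U := by
  have h : Tendsto (fun p : K × K => p.1 * p.2 * p.1⁻¹) (𝓝 1 ×ˢ 𝓝 1) (𝓝 1) := by
    rw [← nhds_prod_eq]
    exact Continuous.tendsto' (by fun_prop) _ _ (by simp)
  obtain ⟨V, hV, V', hV', hVV⟩ := mem_prod_iff.1 (h hU)
  obtain ⟨F, hF, -, hVF⟩ := hK V hV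
  -- Every `g` is `v * f` with `v ∈ V` and `f ∈ F`: conjugation by `f` imposes finitely many
  -- conditions, and conjugation by `v` is uniformly small.
  refine ⟨⋂ f ∈ F, (fun x => f * x * f⁻¹) ⁻¹' V', (biInter_mem hF).2 fun f _ =>
    (by fun_prop : Continuous fun x => f * x * f⁻¹).continuousAt.preimage_mem_nhds
      (by simpa using hV'), fun x hx g => ?_⟩
  obtain ⟨v, hv, f, hf, rfl⟩ := mem_mul.1 (hVF.symm ▸ mem_univ g : g ∈ V * F)
  have : (v, f * x * f⁻¹) ∈ V ×ˢ V' := ⟨hv, mem_iInter₂.1 hx f hf⟩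
  have hmem : v * (f * x * f⁻¹) * v⁻¹ ∈ U := hVV this
  convert hmem using 1
  group

/-- Take the supremum of a metric for the left uniformity over all two-sided translates, truncated
at 1 to be finite. Invariance is a reindexing; balancedness keeps the balls neighborhoods of the
unit. -/
theorem IsTotallyBoundedGroup.exists_groupSeminorm [FirstCountableTopology K]
    (hK : IsTotallyBoundedGroup K) : ∃ ρ : GroupSeminorm K,
      (∀ g x, ρ (g * x * g⁻¹) = ρ x) ∧
        (𝓝 (1 : K)).HasBasis (0 < ·) fun ε : ℝ => {x | ρ x < ε} := by
  let := IsTopologicalGroup.leftUniformSpace K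
  have : (uniformity K).IsCountablyGenerated := by
    rw [uniformity_eq_comap_nhds_one_left]
    infer_instance
  let := UniformSpace.pseudoMetricSpace K
  let d : K → K × K → ℝ := fun x p => min 1 (dist (p.1 * x * p.2) (p.1 * p.2))
  have hbdd : ∀ x, BddAbove (range (d x)) := fun x =>
    ⟨1, by rintro _ ⟨p, rfl⟩; exact min_le_left _ _⟩
  have hnonneg : ∀ x p, 0 ≤ d x p := fun x p => le_min zero_le_one dist_nonneg
  have hle : ∀ x p, d x p ≤ ⨆ p, d x p := fun x p => le_ciSup (hbdd x) p
  have hinv : ∀ x, (⨆ p, d x⁻¹ p) = ⨆ p, d x p := by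
    intro x
    refine (Equiv.prodCongr (Equiv.mulRight x⁻¹) (Equiv.refl K)).iSup_congr fun p => ?_
    simp [d, dist_comm]
  let ρ : GroupSeminorm K :=
    { toFun := fun x => ⨆ p, d x p
      map_one' := by simp [d]
      mul_le' := by
        refine fun x y => ciSup_le fun p => ?_
        have h₁ := hle x (p.1, y * p.2)
        have h₂ := hle y p
        refine le_trans ?_ (add_le_add h₁ h₂)
        have htri := dist_triangle (p.1 * (x * y) * p.2) (p.1 * (y * p.2)) (p.1 * p.2)
        simp only [d, ← mul_assoc] at htri ⊢
        rcases min_cases 1 (dist (p.1 * x * y * p.2) (p.1 * y * p.2)) with h | h <;>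
        rcases min_cases 1 (dist (p.1 * y * p.2) (p.1 * p.2)) with h' | h' <;>
        rcases min_cases 1 (dist (p.1 * x * y * p.2) (p.1 * p.2)) with h'' | h'' <;>
        linarith [dist_nonneg (x := p.1 * x * y * p.2) (y := p.1 * y * p.2),
          dist_nonneg (x := p.1 * y * p.2) (y := p.1 * p.2)]
      inv' := hinv }
  have hρ : ∀ x, ρ x = ⨆ p, d x p := fun _ => rfl
  refine ⟨ρ, fun g x => ?_, ⟨fun W => ⟨fun hW => ?_, ?_⟩⟩⟩
  · rw [hρ, hρ]
    refine (Equiv.prodCongr (Equiv.mulRight g) (Equiv.mulLeft g⁻¹)).iSup_congr fun p => ?_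
    simp [d, mul_assoc]
  · obtain ⟨ε, hε, hεW⟩ := Metric.mem_nhds_iff.1 hW
    refine ⟨min ε 1, lt_min hε one_pos, fun x hx => hεW ?_⟩
    have h₁ : d x 1 < min ε 1 := (hle x 1).trans_lt hx
    simp only [d, Prod.fst_one, Prod.snd_one, one_mul, mul_one] at h₁
    rcases min_lt_iff.1 (h₁.trans_le (min_le_right _ _)) with h | h
    · exact absurd h (lt_irrefl _)
    · rw [min_eq_right h.le] at h₁
      exact h₁.trans_le (min_le_left _ _)
  · rintro ⟨ε, hε, hεW⟩
    have hunif := Metric.dist_mem_uniformity (α := K) (half_pos hε)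
    rw [uniformity_eq_comap_nhds_one_left] at hunif
    obtain ⟨U, hU, hUε⟩ := hunif
    obtain ⟨V, hV, hVU⟩ := hK.exists_forall_conj_mem hU
    -- In the left uniformity `p.1` cancels, leaving the conjugate of `x⁻¹` by `p.2⁻¹`.
    filter_upwards [inv_mem_nhds_one K hV] with x hx
    refine hεW (lt_of_le_of_lt (ciSup_le fun p => ?_) (half_lt_self hε))
    refine (min_le_right _ _).trans (le_of_lt ?_)
    have : (p.1 * x * p.2, p.1 * p.2) ∈ {p : K × K | dist p.1 p.2 < ε / 2} := by
      refine hUε ?_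
      have := hVU x⁻¹ hx p.2⁻¹
      rw [mem_preimage]
      convert this using 1
      simp only
      group
    exact this

end InvariantSeminorm

/-! ### Arc length on the rational circle -/

section ArcLength

/-- A partially additive function on a group, similar to the argument with values in `[0, 1)` on
the circle. -/
structure IsArcLength {M : Type*} [CommGroup M] [TopologicalSpace M] (s : M → ℝ) : Prop where
  nonneg : ∀ t, 0 ≤ s t
  lt_one : ∀ t, s t < 1
  map_one : s 1 = 0
  map_mul : ∀ t t', s t + s t' < 1 → s (t * t') = s t + s t'
  exists_forall_mem : ∀ W ∈ 𝓝 (1 : M), ∃ ε > 0, ∀ t, s t < ε → t ∈ W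
  exists_isOpen : ∀ a b, 0 ≤ a → a < b → b ≤ 1 →
    ∃ P : Set M, IsOpen P ∧ P.Nonempty ∧ ∀ t ∈ P, a < s t ∧ s t < b

/-- The canonical homomorphism from the rationals to the circle. -/
noncomputable def ratToCircle : Multiplicative ℚ →* Multiplicative UnitAddCircle :=
  AddMonoidHom.toMultiplicative
    ((QuotientAddGroup.mk' (AddSubgroup.zmultiples (1 : ℝ))).comp (Rat.castHom ℝ).toAddMonoidHom)

/-- The rational points of the circle. -/
noncomputable def rationalCircle : Subgroup (Multiplicative UnitAddCircle) :=
  ratToCircle.range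

instance : Countable rationalCircle :=
  have : Countable (Multiplicative ℚ) := inferInstanceAs (Countable ℚ)
  (countable_range ratToCircle).to_subtype

theorem isTotallyBoundedGroup_rationalCircle : IsTotallyBoundedGroup rationalCircle :=
  isTotallyBoundedGroup_of_compactSpace.induced rationalCircle.subtype

theorem exists_isArcLength_rationalCircle : ∃ s : rationalCircle → ℝ, IsArcLength s := by
  let s : rationalCircle → ℝ := fun t => AddCircle.equivIco 1 0 t.1.toAdd
  have hmem : ∀ t, s t ∈ Ico (0 : ℝ) 1 := fun t => by
    simpa using (AddCircle.equivIco (1 : ℝ) 0 t.1.toAdd).2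
  have hcoe : ∀ t, ((s t : ℝ) : UnitAddCircle) = t.1.toAdd := fun t =>
    (AddCircle.equivIco (1 : ℝ) 0).symm_apply_apply t.1.toAdd
  have hs : ∀ (t : rationalCircle) (r : ℝ), r ∈ Ico (0 : ℝ) 1 →
      (r : UnitAddCircle) = t.1.toAdd → s t = r := by
    intro t r hr h
    simp only [s, ← h]
    rw [AddCircle.equivIco_coe_eq (by simpa using hr)]
  refine ⟨s, fun t => (hmem t).1, fun t => (hmem t).2, hs _ _ (by simp) rfl, fun t t' h => ?_,
    fun W hW => ?_, fun a b ha hab hb => ?_⟩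
  · refine hs _ _ ⟨add_nonneg (hmem t).1 (hmem t').1, h⟩ ?_
    rw [AddCircle.coe_add, hcoe, hcoe]
    rfl
  · obtain ⟨O, hO, hOW⟩ := mem_nhds_subtype _ _ _ |>.1 hW
    have hcont : Continuous fun r : ℝ => Multiplicative.ofAdd (r : UnitAddCircle) :=
      continuous_ofAdd.comp (AddCircle.continuous_mk' 1)
    obtain ⟨ε, hε, hεO⟩ := Metric.mem_nhds_iff.1
      (hcont.continuousAt.preimage_mem_nhds (x := 0) (t := O) hO)
    refine ⟨ε, hε, fun t ht => hOW ?_⟩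
    have : s t ∈ Metric.ball (0 : ℝ) ε := by
      rwa [mem_ball_zero_iff, Real.norm_eq_abs, abs_of_nonneg (hmem t).1]
    have := hεO this
    rwa [mem_preimage, hcoe] at this
  · refine ⟨{t | t.1.toAdd ∈ ((↑) : ℝ → UnitAddCircle) '' Ioo a b}, ?_, ?_, ?_⟩
    · exact (QuotientAddGroup.isOpenMap_coe _ isOpen_Ioo).preimage
        (continuous_toAdd.comp continuous_subtype_val)
    · obtain ⟨q, hq⟩ := exists_rat_btwn hab
      exact ⟨⟨Multiplicative.ofAdd ((q : ℝ) : UnitAddCircle),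
        MonoidHom.mem_range.2 ⟨Multiplicative.ofAdd q, rfl⟩⟩,
        (q : ℝ), hq, rfl⟩
    · rintro t ⟨r, hr, hrt⟩
      rw [hs t r ⟨ha.trans hr.1.le, hr.2.trans_le hb⟩ hrt]
      exact hr

end ArcLength

/-! ### Paratopological group topologies from a filter at the unit -/

section TranslationTopology

variable {G : Type*} [Group G] {N : Filter G}

/-- The left-invariant topology on a group with a given filter of neighborhoods of the unit. -/
@[reducible]
def translationTopology (N : Filter G) : TopologicalSpace G :=
  TopologicalSpace.mkOfNhds fun g => map (g * ·) N

theorem nhds_translationTopology (h₁ : pure 1 ≤ N) (hmul : ∀ S ∈ N, ∃ W ∈ N, W * W ⊆ S) (g : G) :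
    @nhds G (translationTopology N) g = map (g * ·) N := by
  refine TopologicalSpace.nhds_mkOfNhds _ _ (fun x => ?_) fun a S hS => ?_
  · refine le_trans ?_ (map_mono h₁)
    simp
  · obtain ⟨W, hW, hWS⟩ := hmul _ hS
    filter_upwards [image_mem_map hW]
    rintro _ ⟨w, hw, rfl⟩
    rw [mem_map]
    filter_upwards [hW] with v hv
    simpa [mul_assoc] using hWS (mul_mem_mul hw hv)

theorem nhds_one_translationTopology (h₁ : pure 1 ≤ N) (hmul : ∀ S ∈ N, ∃ W ∈ N, W * W ⊆ S) :
    @nhds G (translationTopology N) 1 = N := by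
  rw [nhds_translationTopology h₁ hmul]
  simp

theorem continuousMul_translationTopology (h₁ : pure 1 ≤ N)
    (hmul : ∀ S ∈ N, ∃ W ∈ N, W * W ⊆ S)
    (hconj : ∀ g : G, Tendsto (fun x => g * x * g⁻¹) N N) :
    @ContinuousMul G (translationTopology N) _ := by
  let := translationTopology N
  have hone : 𝓝 (1 : G) = N := nhds_one_translationTopology h₁ hmul
  have hleft : ∀ g : G, 𝓝 g = map (g * ·) N := nhds_translationTopology h₁ hmul
  refine ContinuousMul.of_nhds_one ?_ (fun g => by rw [hleft, hone]) fun g => ?_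
  · rw [hone]
    intro S hS
    obtain ⟨W, hW, hWS⟩ := hmul S hS
    rw [mem_map]
    exact mem_of_superset (prod_mem_prod hW hW) fun p hp => hWS (Set.mul_mem_mul hp.1 hp.2)
  · rw [hleft, hone]
    -- Left and right translates of `N` agree: conjugation by `g` gives one inclusion and
    -- conjugation by `g⁻¹` the other.
    refine le_antisymm ?_ ?_
    · rw [show (g * ·) = (· * g) ∘ fun x => g * x * g⁻¹ by ext; simp, ← map_map]
      exact map_mono (hconj g)
    · rw [show (· * g) = (g * ·) ∘ fun x => g⁻¹ * x * g by ext; simp [mul_assoc], ← map_map]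
      exact map_mono (by simpa [Tendsto] using hconj g⁻¹)

theorem isInducing_of_comap_nhds_one_eq {H G : Type*} [Group H] [Group G] [TopologicalSpace H]
    [TopologicalSpace G] [SeparatelyContinuousMul H] [SeparatelyContinuousMul G] (f : H →* G)
    (hf : comap f (𝓝 1) = 𝓝 1) : IsInducing f := by
  refine isInducing_iff_nhds.2 fun x => ?_
  have hH := (Homeomorph.mulLeft x⁻¹).nhds_eq_comap x
  have hG := (Homeomorph.mulLeft (f x)⁻¹).nhds_eq_comap (f x)
  simp only [Homeomorph.coe_mulLeft, inv_mul_cancel] at hH hG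
  rw [hH, hG, ← hf, comap_comap, comap_comap]
  congr 1
  ext y
  simp

end TranslationTopology

/-! ### The cone neighborhoods -/

section Cone

variable {H K M : Type*} [Group H] [Group K]

/-- The points `(x, t)` with `s t < ε` such that the `ρ`-distance from `x` to `h '' F` is at most
`s t`. -/
def coneNhd (ρ : GroupSeminorm K) (h : H →* K) (s : M → ℝ) (F : Set H) (ε : ℝ) : Set (K × M) :=
  {p | s p.2 < ε ∧ ∀ η > 0, ∃ u ∈ F, ρ ((h u)⁻¹ * p.1) < s p.2 + η}

variable {ρ : GroupSeminorm K} {h : H →* K} {s : M → ℝ}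

theorem coneNhd_mono {F F' : Set H} {ε ε' : ℝ} (hF : F ⊆ F') (hε : ε ≤ ε') :
    coneNhd ρ h s F ε ⊆ coneNhd ρ h s F' ε' :=
  fun _ hp => ⟨hp.1.trans_le hε, fun η hη => (hp.2 η hη).imp fun _ hu => ⟨hF hu.1, hu.2⟩⟩

variable [TopologicalSpace H]

/-- The filter generated by the sets `coneNhd ρ h s F ε`. -/
def coneFilter (ρ : GroupSeminorm K) (h : H →* K) (s : M → ℝ) : Filter (K × M) where
  sets := {S | ∃ F ∈ 𝓝 (1 : H), ∃ ε > 0, coneNhd ρ h s F ε ⊆ S}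
  univ_sets := ⟨univ, univ_mem, 1, one_pos, subset_univ _⟩
  sets_of_superset := fun ⟨F, hF, ε, hε, hS⟩ hST => ⟨F, hF, ε, hε, hS.trans hST⟩
  inter_sets := fun ⟨F, hF, ε, hε, hS⟩ ⟨F', hF', ε', hε', hS'⟩ =>
    ⟨F ∩ F', inter_mem hF hF', min ε ε', lt_min hε hε', subset_inter
      ((coneNhd_mono inter_subset_left (min_le_left _ _)).trans hS)
      ((coneNhd_mono inter_subset_right (min_le_right _ _)).trans hS')⟩

theorem coneNhd_mem_coneFilter {F : Set H} (hF : F ∈ 𝓝 1) {ε : ℝ} (hε : 0 < ε) :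
    coneNhd ρ h s F ε ∈ coneFilter ρ h s :=
  ⟨F, hF, ε, hε, subset_rfl⟩

theorem pure_one_le_coneFilter
    [CommGroup M] [TopologicalSpace M]
    (hs : IsArcLength s) : pure 1 ≤ coneFilter ρ h s := by
  rintro S ⟨F, hF, ε, hε, hS⟩
  refine hS ⟨by simpa [hs.map_one] using hε, fun η hη => ⟨1, mem_of_mem_nhds hF, ?_⟩⟩
  simpa [hs.map_one] using hη

theorem exists_mul_subset_of_mem_coneFilter
    [ContinuousMul H] [CommGroup M] [TopologicalSpace M]
    (hρ : ∀ g x, ρ (g * x * g⁻¹) = ρ x)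
    (hs : IsArcLength s) : ∀ S ∈ coneFilter ρ h s, ∃ W ∈ coneFilter ρ h s, W * W ⊆ S := by
  rintro S ⟨F, hF, ε, hε, hS⟩
  obtain ⟨F', hFo, hF1, hFF⟩ := exists_open_nhds_one_mul_subset hF
  -- Halving `min ε 1` keeps the sum of two arc lengths below both `ε` and 1, so `s` is additive
  -- here.
  have hε' : 0 < min ε 1 / 2 := half_pos (lt_min hε one_pos)
  refine ⟨_, coneNhd_mem_coneFilter (hFo.mem_nhds hF1) hε', Subset.trans ?_ hS⟩
  rintro _ ⟨⟨x, t⟩, ⟨ht, hx⟩, ⟨y, r⟩, ⟨hr, hy⟩, rfl⟩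
  simp only at ht hx hr hy
  have hadd := hs.map_mul t r (by linarith [min_le_right ε 1])
  refine ⟨?_, fun η hη => ?_⟩
  · simp only [Prod.mk_mul_mk, hadd]
    linarith [min_le_left ε 1]
  · obtain ⟨u, hu, hux⟩ := hx (η / 2) (half_pos hη)
    obtain ⟨v, hv, hvy⟩ := hy (η / 2) (half_pos hη)
    refine ⟨u * v, hFF (mul_mem_mul hu hv), ?_⟩
    simp only [Prod.mk_mul_mk, hadd]
    have hconj := hρ (h v)⁻¹ ((h u)⁻¹ * x)
    have hmul := map_mul_le_add ρ ((h v)⁻¹ * ((h u)⁻¹ * x) * (h v)⁻¹⁻¹) ((h v)⁻¹ * y)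
    rw [hconj] at hmul
    -- Invariance of `ρ` makes distances to `h '' F'` add under multiplication, matching the
    -- additivity of `s`.
    have heq : (h (u * v))⁻¹ * (x * y) =
        (h v)⁻¹ * ((h u)⁻¹ * x) * (h v)⁻¹⁻¹ * ((h v)⁻¹ * y) := by
      rw [map_mul]
      group
    rw [heq]
    linarith

theorem tendsto_conj_coneFilter
    [ContinuousMul H] [CommGroup M] (hρ : ∀ g x, ρ (g * x * g⁻¹) = ρ x)
    (hsurj : Function.Surjective h) (g : K × M) :
    Tendsto (fun x => g * x * g⁻¹) (coneFilter ρ h s) (coneFilter ρ h s) := by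
  rintro S ⟨F, hF, ε, hε, hS⟩
  obtain ⟨a, ha⟩ := hsurj g.1
  have hcont : Continuous fun x => a * x * a⁻¹ := by fun_prop
  rw [mem_map]
  refine mem_of_superset (coneNhd_mem_coneFilter (ε := ε) (F := (fun x => a * x * a⁻¹) ⁻¹' F)
    (hcont.continuousAt.preimage_mem_nhds (by simpa using hF)) hε) fun p hp => hS ?_
  have h₂ : (g * p * g⁻¹).2 = p.2 := by simp
  refine ⟨h₂ ▸ hp.1, fun η hη => ?_⟩
  obtain ⟨u, hu, hup⟩ := hp.2 η hη
  refine ⟨_, hu, ?_⟩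
  rw [h₂]
  convert hup using 1
  rw [← hρ g.1 ((h u)⁻¹ * p.1)]
  congr 1
  simp [← ha, mul_assoc]

theorem coneFilter_le_nhds_one
    [CommGroup M] [TopologicalSpace M] [TopologicalSpace K]
    (hbasis : (𝓝 (1 : K)).HasBasis (0 < ·) fun ε : ℝ => {x | ρ x < ε})
    (hh : Continuous h) (hs : IsArcLength s) : coneFilter ρ h s ≤ 𝓝 (1 : K × M) := by
  intro S hS
  obtain ⟨V, hV, W, hW, hVW⟩ := mem_nhds_prod_iff.1 hS
  obtain ⟨δ, hδ, hδV⟩ := hbasis.mem_iff.1 hV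
  obtain ⟨ε, hε, hεW⟩ := hs.exists_forall_mem W hW
  have hF : h ⁻¹' {x | ρ x < δ / 3} ∈ 𝓝 (1 : H) :=
    hh.continuousAt.preimage_mem_nhds (by simpa using hbasis.mem_of_mem (i := δ / 3) (by linarith))
  refine mem_of_superset (coneNhd_mem_coneFilter hF (lt_min hε (by linarith : 0 < δ / 3)))
    fun p hp => hVW ⟨hδV ?_, hεW _ (hp.1.trans_le (min_le_left _ _))⟩
  obtain ⟨u, hu, hup⟩ := hp.2 (δ / 3) (by linarith)
  have hmul := map_mul_le_add ρ (h u) ((h u)⁻¹ * p.1)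
  rw [mul_inv_cancel_left] at hmul
  have h₁ : ρ (h u) < δ / 3 := hu
  have h₂ := hp.1.trans_le (min_le_right _ _)
  exact (by linarith : ρ p.1 < δ)

/-- A ball times an arc, with `s` on the arc above the radius of the ball, lies in the cone; `1 ∈ F`
serves as the nearby point. Since `s 1 = 0`, the unit is avoided. -/
theorem exists_isOpen_subset_of_mem_coneFilter
    [CommGroup M] [TopologicalSpace M] [TopologicalSpace K]
    (hbasis : (𝓝 (1 : K)).HasBasis (0 < ·) fun ε : ℝ => {x | ρ x < ε}) (hs : IsArcLength s)
    {S : Set (K × M)} (hS : S ∈ coneFilter ρ h s) :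
    ∃ P ⊆ S, IsOpen P ∧ P.Nonempty ∧ 1 ∉ P := by
  obtain ⟨F, hF, ε, hε, hS⟩ := hS
  have hε' : 0 < min ε 1 := lt_min hε one_pos
  obtain ⟨Q, hQ, hQne, hQs⟩ := hs.exists_isOpen (min ε 1 / 2) (min ε 1) (half_pos hε').le
    (half_lt_self hε') (min_le_right _ _)
  refine ⟨interior {x | ρ x < min ε 1 / 2} ×ˢ Q, fun p hp => hS ⟨?_, fun η hη => ?_⟩,
    isOpen_interior.prod hQ, Nonempty.prod ⟨1, ?_⟩ hQne, fun h1 => ?_⟩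
  · exact (hQs _ hp.2).2.trans_le (min_le_left _ _)
  · refine ⟨1, mem_of_mem_nhds hF, ?_⟩
    have h₁ : p.1 ∈ {x | ρ x < min ε 1 / 2} := interior_subset hp.1
    replace h₁ : ρ p.1 < min ε 1 / 2 := h₁
    have h₂ := (hQs _ hp.2).1
    rw [map_one, inv_one, one_mul]
    linarith
  · exact mem_interior_iff_mem_nhds.2 (hbasis.mem_of_mem (half_pos hε'))
  · have h₁ := (hQs _ h1.2).1
    rw [Prod.snd_one, hs.map_one] at h₁
    linarith

theorem comap_coneFilter
    [CommGroup M] [TopologicalSpace M] [TopologicalSpace K] [IsTopologicalGroup K]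
    (hbasis : (𝓝 (1 : K)).HasBasis (0 < ·) fun ε : ℝ => {x | ρ x < ε})
    (hs : IsArcLength s)
    (hh : ∀ U ∈ 𝓝 (1 : H), ∃ C : Set K, IsClosed C ∧ h ⁻¹' C ∈ 𝓝 1 ∧ h ⁻¹' C ⊆ U) :
    comap ((MonoidHom.inl K M).comp h) (coneFilter ρ h s) = 𝓝 1 := by
  refine le_antisymm (fun U hU => ?_) ?_
  · obtain ⟨C, hC, hCn, hCU⟩ := hh U hU
    refine ⟨_, coneNhd_mem_coneFilter hCn one_pos, fun x hx => hCU ?_⟩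
    rw [mem_preimage, ← hC.closure_eq, mem_closure_iff_forall_mem_nhds_one]
    intro O hO
    obtain ⟨η, hη, hηO⟩ := hbasis.mem_iff.1 hO
    obtain ⟨u, hu, hux⟩ := hx.2 η hη
    refine ⟨h u, hu, hηO ?_⟩
    have : ρ ((h x)⁻¹ * h u) < η := by
      rw [← map_inv_eq_map ρ]
      simpa [hs.map_one] using hux
    exact this
  · rw [← map_le_iff_le_comap]
    rintro S ⟨F, hF, ε, hε, hS⟩
    rw [mem_map]
    refine mem_of_superset hF fun x hx => hS ⟨?_, fun η hη => ⟨x, hx, ?_⟩⟩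
    · simpa [hs.map_one] using hε
    · simpa [hs.map_one] using hη

/-- Making the bound on `s` non-strict closes the cone. The one-sidedness of `s` matters: points `p
* q` approaching `p` satisfy `s (p * q).2 = s p.2 + s q.2`, so there is no wrapping around the
circle. -/
theorem exists_isClosed_subset_of_mem_coneFilter
    [CommGroup M] [TopologicalSpace M] [TopologicalSpace K] [TopologicalSpace (K × M)]
    [SeparatelyContinuousMul (K × M)] (hnhds : 𝓝 (1 : K × M) = coneFilter ρ h s)
    (hbasis : (𝓝 (1 : K)).HasBasis (0 < ·) fun ε : ℝ => {x | ρ x < ε}) (hh : Continuous h)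
    (hs : IsArcLength s) {S : Set (K × M)} (hS : S ∈ 𝓝 1) : ∃ C ∈ 𝓝 1, IsClosed C ∧ C ⊆ S := by
  rw [hnhds] at hS ⊢
  obtain ⟨F, hF, ε, hε, hS⟩ := hS
  refine ⟨{p | s p.2 ≤ ε / 2 ∧ ∀ η > 0, ∃ u ∈ F, ρ ((h u)⁻¹ * p.1) < s p.2 + η},
    mem_of_superset (coneNhd_mem_coneFilter hF (half_pos hε)) fun p hp => ⟨hp.1.le, hp.2⟩,
    isClosed_of_closure_subset fun p hp => ?_,
    fun p hp => hS ⟨hp.1.trans_lt (half_lt_self hε), hp.2⟩⟩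
  rw [mem_closure_iff_forall_mem_nhds_one, hnhds] at hp
  have key : ∀ η > 0, s p.2 ≤ ε / 2 ∧ ∃ u ∈ F, ρ ((h u)⁻¹ * p.1) < s p.2 + η := by
    intro η hη
    -- Five errors add up: `s q.2` counted twice, `ρ (h v)`, and the slack of the two cone
    -- conditions.
    have hη' : 0 < η / 5 := by linarith
    have hF' : h ⁻¹' {x | ρ x < η / 5} ∈ 𝓝 (1 : H) :=
      hh.continuousAt.preimage_mem_nhds (by simpa using hbasis.mem_of_mem hη')
    obtain ⟨a, ⟨ha, haF⟩, har, haη⟩ := hp _ (coneNhd_mem_coneFilter hF'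
      (lt_min (sub_pos.2 (hs.lt_one p.2)) hη'))
    obtain ⟨q, rfl⟩ : ∃ q, a = p * q := ⟨p⁻¹ * a, by group⟩
    rw [inv_mul_cancel_left] at har haη
    have h₁ := har.trans_le (min_le_left _ _)
    have h₂ := har.trans_le (min_le_right _ _)
    have hadd : s (p * q).2 = s p.2 + s q.2 := hs.map_mul _ _ (by linarith)
    rw [hadd] at ha haF
    refine ⟨by linarith [hs.nonneg q.2], ?_⟩
    obtain ⟨v, hv, hvq⟩ := haη (η / 5) hη'
    obtain ⟨u, hu, hup⟩ := haF (η / 5) hη'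
    refine ⟨u, hu, ?_⟩
    have hv' : ρ (h v) < η / 5 := hv
    have h₃ := map_mul_le_add ρ (h v) ((h v)⁻¹ * q.1)
    have h₄ := map_mul_le_add ρ ((h u)⁻¹ * (p * q).1) q.1⁻¹
    rw [mul_inv_cancel_left] at h₃
    rw [map_inv_eq_map, Prod.fst_mul, mul_assoc, mul_inv_cancel_right] at h₄
    rw [Prod.fst_mul] at hup
    linarith
  exact ⟨(key 1 one_pos).1, fun η hη => (key η hη).2⟩

end Cone

/-! ### Recognizing the group reflexion -/

section FlatTopology

/-- If a paratopological group topology `τ` is finer than a group topology `t` and every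
neighborhood of the unit in `τ` contains a nonempty `t`-open set, then `t` is the topology of the
group reflexion. -/
theorem flatTopology_eq_of_exists_isOpen {G : Type u} [Group G] {τ t : TopologicalSpace G}
    (ht : @IsTopologicalGroup G t _) (hle : τ ≤ t)
    (hopen : ∀ S ∈ @nhds G τ 1, ∃ P ⊆ S, IsOpen[t] P ∧ P.Nonempty) :
    @flatTopology G _ τ = t := by
  have hflat : @IsTopologicalGroup G (@flatTopology G _ τ) _ :=
    @isTopologicalGroup_flatTopology G _ τ
  have hflatle : @flatTopology G _ τ ≤ t := (@isLeast_flatTopology G _ τ).2 ⟨hle, ht⟩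
  refine IsTopologicalGroup.ext hflat ht (le_antisymm (nhds_mono hflatle) fun O hO => ?_)
  obtain ⟨V, hV, hVO⟩ := (let := @flatTopology G _ τ; exists_nhds_split_inv hO)
  obtain ⟨P, hPV, hP, p, hp⟩ := hopen V (nhds_mono (@le_flatTopology G _ τ) hV)
  -- The set `P * p⁻¹` is a `t`-neighborhood of the unit contained in `V * V⁻¹`, hence in `O`.
  have hmem : (· * p) ⁻¹' P ∈ 𝓝 (1 : G) :=
    (hP.preimage (continuous_mul_const p)).mem_nhds (by simpa using hp)
  filter_upwards [hmem] with z hz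
  simpa using hVO _ (hPV hz) _ (hPV hp)

end FlatTopology

/-! ### Character and quotient of the cone topology -/

section Cone

theorem IsNhdsBase.character_le {G : Type u} [Group G] [t : TopologicalSpace G]
    [SeparatelyContinuousMul G] {B : Set (Set G)} (hB : IsNhdsBase t 1 B) : character t ≤ #B := by
  refine _root_.character_le fun x => ?_
  have hx : 𝓝 x = comap (x⁻¹ * ·) (𝓝 1) := by
    simpa using (Homeomorph.mulLeft x⁻¹).nhds_eq_comap x
  refine ⟨((x⁻¹ * ·) ⁻¹' ·) '' B, ⟨?_, fun U hU => ?_⟩, Cardinal.mk_image_le⟩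
  · rintro _ ⟨V, hV, rfl⟩
    exact hx ▸ preimage_mem_comap (hB.1 V hV)
  · obtain ⟨W, hW, hWU⟩ := hx ▸ hU
    obtain ⟨V, hV, hVW⟩ := hB.2 W hW
    exact ⟨_, ⟨V, hV, rfl⟩, (preimage_mono hVW).trans hWU⟩

theorem character_le_of_nhds_one_eq_coneFilter {H K : Type u} {M : Type} [Group H] [Group K]
    [Group M] [tH : TopologicalSpace H] [t : TopologicalSpace (K × M)]
    [SeparatelyContinuousMul (K × M)] {ρ : GroupSeminorm K} {h : H →* K} {s : M → ℝ}
    (hnhds : 𝓝 (1 : K × M) = coneFilter ρ h s) : character t ≤ max (character tH) ℵ₀ := by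
  obtain ⟨B, hB, hcard⟩ := exists_isNhdsBase_mk_le_character tH (1 : H)
  have hbase : IsNhdsBase t 1
      (range fun p : B × ℕ => coneNhd ρ h s (p.1 : Set H) (1 / ((p.2 : ℝ) + 1))) := by
    refine ⟨?_, fun U hU => ?_⟩
    · rintro _ ⟨p, rfl⟩
      rw [hnhds]
      exact coneNhd_mem_coneFilter (hB.1 _ p.1.2) (by positivity)
    · rw [hnhds] at hU
      obtain ⟨F, hF, ε, hε, hFU⟩ := hU
      obtain ⟨V, hV, hVF⟩ := hB.2 F hF
      obtain ⟨n, hn⟩ := exists_nat_one_div_lt hε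
      exact ⟨_, ⟨(⟨V, hV⟩, n), rfl⟩, (coneNhd_mono hVF hn.le).trans hFU⟩
  refine hbase.character_le.trans (Cardinal.mk_range_le.trans ?_)
  rw [Cardinal.mk_prod, Cardinal.lift_uzero, Cardinal.mk_nat, Cardinal.lift_aleph0]
  exact (Cardinal.mul_le_max_of_aleph0_le_right le_rfl).trans (max_le_max_right _ hcard)

theorem mk_quotient_range_inl_comp_le_aleph0 {H K M : Type*} [Group H] [Group K] [Group M]
    [Countable M] {h : H →* K} (hsurj : Function.Surjective h) :
    #((K × M) ⧸ ((MonoidHom.inl K M).comp h).range) ≤ ℵ₀ := by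
  have hsurj' : Function.Surjective fun m : M =>
      (QuotientGroup.mk (1, m) : (K × M) ⧸ ((MonoidHom.inl K M).comp h).range) := by
    intro q
    obtain ⟨⟨k, m⟩, rfl⟩ := QuotientGroup.mk_surjective q
    obtain ⟨x, rfl⟩ := hsurj k
    exact ⟨m, QuotientGroup.eq.2 ⟨x, by simp⟩⟩
  exact Cardinal.mk_le_aleph0_iff.2 hsurj'.countable

theorem coe_range_inl_comp {H K M : Type*} [Group H] [Group K] [Group M] {h : H →* K}
    (hsurj : Function.Surjective h) :
    (((MonoidHom.inl K M).comp h).range : Set (K × M)) = Prod.snd ⁻¹' {1} := by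
  ext ⟨k, m⟩
  obtain ⟨x, rfl⟩ := hsurj k
  refine ⟨?_, ?_⟩
  · rintro ⟨y, hy⟩
    exact (congrArg Prod.snd hy).symm
  · rintro rfl
    exact ⟨x, rfl⟩

end Cone

theorem IsFcBohrRegular.exists_isEmbedding {H : Type u} [Group H] [tH : TopologicalSpace H]
    [ContinuousMul H] [T2Space H] (hH : IsFcBohrRegular H) :
    ∃ (G : Type u) (_ : Group G) (tG : TopologicalSpace G) (_ : ContinuousMul G) (_ : T3Space G)
        (f : H →* G),
        IsTotallyBoundedGroup G ∧
        IsEmbedding f ∧ IsFlatClosed (f.range : Set G) ∧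
        ℵ₀ = character (flatTopology G) ∧
        character (flatTopology G) ≤ character tG ∧
        character tG = max (character tH) ℵ₀ ∧
        #(G ⧸ f.range) ≤ ℵ₀ := by
  obtain ⟨K, _, tK, _, _, _, h, hK, hsurj, hcont, hreg⟩ := hH
  obtain ⟨ρ, hρ, hbasis⟩ := hK.exists_groupSeminorm
  obtain ⟨s, hs⟩ := exists_isArcLength_rationalCircle
  have hKM : IsTotallyBoundedGroup (K × rationalCircle) :=
    hK.prod isTotallyBoundedGroup_rationalCircle
  have hpure : pure 1 ≤ coneFilter ρ h s := pure_one_le_coneFilter hs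
  have hmul := exists_mul_subset_of_mem_coneFilter (h := h) hρ hs
  let tP : TopologicalSpace (K × rationalCircle) := inferInstance
  have hP : IsTopologicalGroup (K × rationalCircle) := inferInstance
  have hT2 : T2Space (K × rationalCircle) := inferInstance
  have hcover := fun P : Set (K × rationalCircle) => hKM.exists_finite_of_isOpen (P := P)
  have hclosed : IsClosed (Prod.snd ⁻¹' {1} : Set (K × rationalCircle)) :=
    isClosed_singleton.preimage continuous_snd
  have hcharP : (𝓝[≠] (1 : K × rationalCircle)).NeBot → character tP = ℵ₀ := fun _ =>
    le_antisymm character_le_aleph0 (aleph0_le_character 1)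
  let tG := translationTopology (coneFilter ρ h s)
  have hnhds : @nhds _ tG 1 = coneFilter ρ h s := nhds_one_translationTopology hpure hmul
  have hGmul : @ContinuousMul _ tG _ :=
    continuousMul_translationTopology hpure hmul (tendsto_conj_coneFilter hρ hsurj)
  have hle : tG ≤ tP := by
    refine le_of_nhds_le_nhds fun x => ?_
    rw [nhds_translationTopology hpure hmul, ← @map_mul_left_nhds_one _ tP]
    exact map_mono (coneFilter_le_nhds_one hbasis hcont hs)
  have hopen : ∀ S ∈ @nhds _ tG 1, ∃ P ⊆ S, IsOpen[tP] P ∧ P.Nonempty ∧ 1 ∉ P := fun S hS =>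
    exists_isOpen_subset_of_mem_coneFilter hbasis hs (hnhds ▸ hS)
  have hflat : @flatTopology _ _ tG = tP := flatTopology_eq_of_exists_isOpen hP hle fun S hS =>
    (hopen S hS).imp fun P hP => ⟨hP.1, hP.2.1, hP.2.2.1⟩
  have hTB : @IsTotallyBoundedGroup _ _ tG := by
    intro U hU
    obtain ⟨P, hPU, hPo, hPne, -⟩ := hopen U hU
    obtain ⟨F, hF, hFP, hPF⟩ := hcover P hPo hPne
    exact ⟨F, hF, eq_univ_of_univ_subset (hFP ▸ mul_subset_mul_left hPU),
      eq_univ_of_univ_subset (hPF ▸ mul_subset_mul_right hPU)⟩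
  -- The unit is not isolated, whether or not `H` is discrete; this makes both characters at least
  -- `ℵ₀`.
  have hne : (@nhdsWithin _ tG 1 {1}ᶜ).NeBot := by
    refine @mem_closure_iff_nhdsWithin_neBot _ tG _ _ |>.1 ?_
    refine (@mem_closure_iff_nhds _ tG _ _).2 fun S hS => ?_
    obtain ⟨P, hPS, -, ⟨p, hp⟩, h1⟩ := hopen S hS
    exact ⟨p, hPS hp, fun hp1 => h1 (hp1 ▸ hp)⟩
  have hT2G : @T2Space _ tG :=
    @T2Space.of_injective_continuous _ _ tG tP hT2 id Function.injective_id
      (continuous_id_iff_le.2 hle)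
  have hT3 : @T3Space _ tG := by
    have : @RegularSpace _ tG := by
      refine @RegularSpace.of_exists_mem_nhds_isClosed_subset _ tG fun x S hS => ?_
      have hx : @ContinuousAt _ _ tG tG (x * ·) 1 :=
        (@continuous_const_mul _ tG _ _ x).continuousAt
      have hx' : @ContinuousAt _ _ tG tG (x⁻¹ * ·) x :=
        (@continuous_const_mul _ tG _ _ x⁻¹).continuousAt
      obtain ⟨C, hC, hCc, hCS⟩ := @exists_isClosed_subset_of_mem_coneFilter _ _ _ _ _ ρ h s _ _ _ _
        tG _ hnhds hbasis hcont hs _ (hx.preimage_mem_nhds (by simpa using hS))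
      refine ⟨(x⁻¹ * ·) ⁻¹' C, hx'.preimage_mem_nhds (by simpa using hC),
        hCc.preimage (@continuous_const_mul _ tG _ _ x⁻¹), fun y hy => ?_⟩
      simpa using hCS hy
    exact @T3Space.mk _ tG inferInstance this
  let f : H →* K × rationalCircle := (MonoidHom.inl K rationalCircle).comp h
  have hf : @IsEmbedding _ _ tH tG f := by
    refine (@isInducing_of_comap_nhds_one_eq _ _ _ _ tH tG _ _ f ?_).isEmbedding
    rw [hnhds]
    refine comap_coneFilter hbasis hs fun U hU => ?_
    obtain ⟨C, hC, -, hCn, hCU⟩ := hreg 1 U hU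
    exact ⟨C, hC, hCn, hCU⟩
  have hflatchar : @character _ tP = ℵ₀ :=
    hcharP (hne.mono (inf_le_inf_right _ (nhds_mono hle)))
  have hGchar : ℵ₀ ≤ @character _ tG := @aleph0_le_character _ tG inferInstance 1 hne
  refine ⟨K × rationalCircle, inferInstance, tG, hGmul, hT3, f, hTB, hf, ?_, ?_, ?_, ?_, ?_⟩
  · rw [IsFlatClosed, hflat, coe_range_inl_comp hsurj]
    exact hclosed
  · rw [hflat, hflatchar]
  · rw [hflat, hflatchar]
    exact hGchar
  · refine le_antisymm ?_ (max_le hf.isInducing.character_le hGchar)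
    exact character_le_of_nhds_one_eq_coneFilter hnhds
  · exact mk_quotient_range_inl_comp_le_aleph0 hsurj

theorem corollary6 (H : Type u) [Group H] [tH : TopologicalSpace H] [ContinuousMul H] [T2Space H] :
    IsFcBohrRegular H ↔
      ∃ (G : Type u) (_ : Group G) (tG : TopologicalSpace G) (_ : ContinuousMul G) (_ : T3Space G)
        (f : H →* G),
        IsTotallyBoundedGroup G ∧
        IsEmbedding f ∧ IsFlatClosed (f.range : Set G) ∧
        ℵ₀ = character (flatTopology G) ∧
        character (flatTopology G) ≤ character tG ∧
        character tG = max (character tH) ℵ₀ ∧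
        #(G ⧸ f.range) ≤ ℵ₀ := by
  refine ⟨IsFcBohrRegular.exists_isEmbedding, ?_⟩
  rintro ⟨G, _, tG, _, _, f, hG, hf, -, hchar, -, -, -⟩
  exact hG.isFcBohrRegular hchar.ge hf
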